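/- Let $\mathbb{D}=\{z\in\mathbb{C}:|z|<1\}$, and let $(\phi_t)_{t\ge 0}$ be a one-parameter continuous semigroup of holomorphic self-maps of $\mathbb{D}$, that is, a family of holomorphic functions $\phi_t:\mathbb{D}\to\mathbb{D}$ such that $\phi_0=\mathrm{id}_{\mathbb{D}}$, $\phi_{t+s}=\phi_t\circ\phi_s$ for all $t,s\ge 0$, and $\lim_{t\to 0^+}\phi_t(z)=z$ for all $z\in\mathbb{D}$. Suppose that $(\phi_t)$ is elliptic with Denjoy–Wolff point $\tau$, that is, $\tau\in\mathbb{D}$ and $\lim_{t\to+\infty}\phi_t(z)=\tau$ for every $z\in\mathbb{D}$. Let $\lambda\in\mathbb{C}$ be its spectral value, that is, the number for which $\phi_t'(\tau)=e^{-\lambda t}$ for all $t\ge 0$ (necessarily $\operatorname{Re}\lambda>0$). Then, for every $z\in\mathbb{D}\setminus\{\tau\}$, $$\lim_{t\to+\infty}\left(\frac{1}{t}\log|\phi_t(z)-\tau|\right)=-\operatorname{Re}\lambda .$$ -/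

import Mathlib

open Filter Topology

/-- A (one-parameter continuous) semigroup of holomorphic self-maps of the unit disk
`𝔻 = Metric.ball 0 1`. Only the values `φ t z` with `0 ≤ t` and `z ∈ 𝔻` are constrained. -/
structure IsDiskSemigroup (φ : ℝ → ℂ → ℂ) : Prop where
  differentiableOn : ∀ t : ℝ, 0 ≤ t → DifferentiableOn ℂ (φ t) (Metric.ball 0 1)
  mapsTo : ∀ t : ℝ, 0 ≤ t → Set.MapsTo (φ t) (Metric.ball 0 1) (Metric.ball 0 1)
  map_zero : ∀ z ∈ Metric.ball (0 : ℂ) 1, φ 0 z = z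
  map_add : ∀ t s : ℝ, 0 ≤ t → 0 ≤ s → ∀ z ∈ Metric.ball (0 : ℂ) 1,
    φ (t + s) z = φ t (φ s z)
  tendsto_zero : ∀ z ∈ Metric.ball (0 : ℂ) 1, Tendsto (fun t : ℝ => φ t z) (𝓝[>] 0) (𝓝 z)

/-- `τ` is the Denjoy-Wolff point of `φ`: a point of the closed unit disk to which every forward
orbit `t ↦ φ t z`, `z ∈ 𝔻`, converges. -/
def IsDenjoyWolffPoint (φ : ℝ → ℂ → ℂ) (τ : ℂ) : Prop :=
  τ ∈ Metric.closedBall (0 : ℂ) 1 ∧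
    ∀ z ∈ Metric.ball (0 : ℂ) 1, Tendsto (fun t : ℝ => φ t z) atTop (𝓝 τ)

/-- `φ` is an elliptic semigroup with Denjoy-Wolff point `τ`: the Denjoy-Wolff point lies in the
open unit disk. -/
structure IsEllipticSemigroup (φ : ℝ → ℂ → ℂ) (τ : ℂ) : Prop where
  isDiskSemigroup : IsDiskSemigroup φ
  isDenjoyWolffPoint : IsDenjoyWolffPoint φ τ
  mem_disk : τ ∈ Metric.ball (0 : ℂ) 1

/-- `l` is the spectral value of a semigroup `φ` with Denjoy-Wolff point `τ` in the open unit
disk: the number with `φ_t'(τ) = exp (-l t)` for all `t ≥ 0`. -/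
def IsSpectralValue (φ : ℝ → ℂ → ℂ) (τ l : ℂ) : Prop :=
  ∀ t : ℝ, 0 ≤ t → HasDerivAt (φ t) (Complex.exp (-l * t)) τ

/-!
Write `C = 2 / (1 - ‖τ‖)`. Since every `φ t` maps the disk into itself, the Schwarz lemma gives
`‖φ t w - φ t p‖ ≤ 2 / (1 - ‖p‖) * ‖w - p‖` uniformly in `t`
(`IsDiskSemigroup.dist_map_le`). As `τ` is a common fixed point, `‖φ t w - τ‖ ≤ C * ‖w - τ‖`.

*Integer times.* Put `zₙ = φ n z`. Then `zₙ₊₁ = φ 1 zₙ` and `zₙ → τ`, so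
`(zₙ₊₁ - τ) / (zₙ - τ)` tends to `(φ 1)'(τ) = exp (-l)`; taking logarithms and Cesàro means,
`log ‖zₙ - τ‖ / n → -Re l` (`tendsto_log_norm_nat_div`). No linearising (Koenigs) map is needed.

*Real times.* For `n ≤ t ≤ n + 1` the uniform bound yields
`‖zₙ₊₁ - τ‖ / C ≤ ‖φ t z - τ‖ ≤ C * ‖zₙ - τ‖`, which costs only a bounded amount in the logarithm.

*Orbits never reach `τ`.* The logarithms are meaningful only if `φ t z ≠ τ` for `z ≠ τ`
(`IsEllipticSemigroup.map_ne`). Applying the Schwarz lemma twice, to `φ h` and to its difference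
quotient at `τ`, shows that a zero of `φ h - τ` other than `τ` stays at distance at least
`‖(φ h)'(τ)‖ / M` from `τ`, which is bounded below for `h ∈ [0, 1]`. If an orbit hit `τ`, then for
each small step `h` there would be a last point `φ s z ≠ τ` with `φ h (φ s z) = τ`, and
`‖φ s z - τ‖ = ‖φ s z - φ s (φ h z)‖` is at most a constant times `‖z - φ h z‖`, which tends
to `0` with `h`.
-/

/-! ### Uniform Schwarz estimates -/

lemma ball_one_sub_norm_subset (p : ℂ) :
    Metric.ball p (1 - ‖p‖) ⊆ Metric.ball (0 : ℂ) 1 :=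
  Metric.ball_subset_ball' (by simp)

/-- A holomorphic self-map of the disk is Lipschitz at each `p`, with a constant depending only
on `p`. -/
lemma dist_map_le_of_mapsTo_ball {f : ℂ → ℂ} (hd : DifferentiableOn ℂ f (Metric.ball 0 1))
    (hm : Set.MapsTo f (Metric.ball 0 1) (Metric.ball 0 1)) {p w : ℂ}
    (hp : p ∈ Metric.ball (0 : ℂ) 1) (hw : w ∈ Metric.ball (0 : ℂ) 1) :
    dist (f w) (f p) ≤ 2 / (1 - ‖p‖) * dist w p := by
  have hr : 0 < 1 - ‖p‖ := by simpa using hp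
  have h2 : ∀ v ∈ Metric.ball (0 : ℂ) 1, f v ∈ Metric.ball (f p) 2 := by
    intro v hv
    have h1 := hm hv
    have h3 := hm hp
    rw [Metric.mem_ball] at *
    linarith [dist_triangle_right (f v) (f p) 0]
  by_cases h : w ∈ Metric.ball p (1 - ‖p‖)
  · exact Complex.dist_le_div_mul_dist_of_mapsTo_ball (hd.mono (ball_one_sub_norm_subset p))
      (fun v hv => Metric.ball_subset_closedBall (h2 v (ball_one_sub_norm_subset p hv))) h
  · -- Far from `p` the right-hand side exceeds the diameter of the disk.
    have h1 : 1 - ‖p‖ ≤ dist w p := by simpa using h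
    have h3 : dist (f w) (f p) < 2 := h2 w hw
    have h4 : 2 ≤ 2 / (1 - ‖p‖) * dist w p := by
      rw [div_mul_eq_mul_div, le_div_iff₀ hr]
      linarith
    linarith

/-- If a holomorphic self-map of the disk fixes `τ`, its other preimages of `τ` are kept away from
`τ` by the size of the derivative there. This is the Schwarz lemma for the difference quotient
`dslope f τ`, which is bounded by the Schwarz lemma for `f`. -/
lemma norm_deriv_le_mul_dist_of_map_eq {f : ℂ → ℂ}
    (hd : DifferentiableOn ℂ f (Metric.ball 0 1))
    (hm : Set.MapsTo f (Metric.ball 0 1) (Metric.ball 0 1)) {τ w : ℂ}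
    (hτ : τ ∈ Metric.ball (0 : ℂ) 1) (hfix : f τ = τ) (hw : w ∈ Metric.ball τ (1 - ‖τ‖))
    (hne : w ≠ τ) (hfw : f w = τ) :
    ‖deriv f τ‖ ≤ 2 * (2 / (1 - ‖τ‖)) / (1 - ‖τ‖) * dist w τ := by
  have hr : 0 < 1 - ‖τ‖ := by simpa using hτ
  have hsub := ball_one_sub_norm_subset τ
  have hτr : τ ∈ Metric.ball τ (1 - ‖τ‖) := Metric.mem_ball_self hr
  have hmaps : Set.MapsTo f (Metric.ball τ (1 - ‖τ‖)) (Metric.closedBall (f τ) 2) := by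
    intro v hv
    have h1 := hm (hsub hv)
    have h3 := hm hτ
    rw [Metric.mem_ball] at h1 h3
    rw [Metric.mem_closedBall]
    linarith [dist_triangle_right (f v) (f τ) 0]
  have hb : ∀ v ∈ Metric.ball τ (1 - ‖τ‖), ‖dslope f τ v‖ ≤ 2 / (1 - ‖τ‖) := fun v hv =>
    Complex.norm_dslope_le_div_of_mapsTo_ball (hd.mono hsub) hmaps hv
  have hdd : DifferentiableOn ℂ (dslope f τ) (Metric.ball τ (1 - ‖τ‖)) :=
    (Complex.differentiableOn_dslope (Metric.isOpen_ball.mem_nhds hτr)).2 (hd.mono hsub)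
  have key := Complex.dist_le_div_mul_dist_of_mapsTo_ball (R₂ := 2 * (2 / (1 - ‖τ‖))) hdd
    (fun v hv => by
      rw [Metric.mem_closedBall, dist_eq_norm]
      linarith [norm_sub_le (dslope f τ v) (dslope f τ τ), hb v hv, hb τ hτr]) hw
  rw [dslope_of_ne _ hne, slope_def_field, hfw, hfix, sub_self, zero_div, dslope_same,
    dist_zero_left] at key
  exact key

/-! ### Orbits of an elliptic semigroup -/

lemma IsDiskSemigroup.dist_map_le {φ : ℝ → ℂ → ℂ} (h : IsDiskSemigroup φ) {t : ℝ} (ht : 0 ≤ t)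
    {p w : ℂ} (hp : p ∈ Metric.ball (0 : ℂ) 1) (hw : w ∈ Metric.ball (0 : ℂ) 1) :
    dist (φ t w) (φ t p) ≤ 2 / (1 - ‖p‖) * dist w p :=
  dist_map_le_of_mapsTo_ball (h.differentiableOn t ht) (h.mapsTo t ht) hp hw

lemma IsEllipticSemigroup.map_fixed {φ : ℝ → ℂ → ℂ} {τ : ℂ} (h : IsEllipticSemigroup φ τ)
    {t : ℝ} (ht : 0 ≤ t) : φ t τ = τ := by
  have hs := h.isDiskSemigroup
  have hlim := h.isDenjoyWolffPoint.2 τ h.mem_disk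
  have hc : ContinuousAt (φ t) τ :=
    ((hs.differentiableOn t ht).differentiableAt
      (Metric.isOpen_ball.mem_nhds h.mem_disk)).continuousAt
  have h1 : Tendsto (fun s => φ t (φ s τ)) atTop (𝓝 (φ t τ)) := hc.tendsto.comp hlim
  have h2 : Tendsto (fun s => φ (t + s) τ) atTop (𝓝 τ) :=
    hlim.comp (tendsto_atTop_add_const_left _ t tendsto_id)
  refine tendsto_nhds_unique (h1.congr' ?_) h2
  filter_upwards [eventually_ge_atTop 0] with s hs0
  exact (hs.map_add t s ht hs0 τ h.mem_disk).symm

lemma IsEllipticSemigroup.norm_map_sub_le {φ : ℝ → ℂ → ℂ} {τ : ℂ}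
    (h : IsEllipticSemigroup φ τ) {t : ℝ} (ht : 0 ≤ t) {w : ℂ}
    (hw : w ∈ Metric.ball (0 : ℂ) 1) : ‖φ t w - τ‖ ≤ 2 / (1 - ‖τ‖) * ‖w - τ‖ := by
  have := h.isDiskSemigroup.dist_map_le ht h.mem_disk hw
  rwa [h.map_fixed ht, dist_eq_norm, dist_eq_norm] at this

/-- For `h ∈ [0, 1]`, the preimages of `τ` under `φ h` other than `τ` avoid a fixed neighbourhood
of `τ`. -/
lemma IsEllipticSemigroup.exists_pos_le_dist {φ : ℝ → ℂ → ℂ} {τ l : ℂ}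
    (hφ : IsEllipticSemigroup φ τ) (hl : IsSpectralValue φ τ l) :
    ∃ c > 0, ∀ h : ℝ, 0 ≤ h → h ≤ 1 → ∀ w : ℂ, w ≠ τ → φ h w = τ → c ≤ dist w τ := by
  have hr : 0 < 1 - ‖τ‖ := by simpa using hφ.mem_disk
  have hM : 0 < 2 * (2 / (1 - ‖τ‖)) / (1 - ‖τ‖) := by positivity
  refine ⟨min (1 - ‖τ‖) (Real.exp (-|l.re|) / (2 * (2 / (1 - ‖τ‖)) / (1 - ‖τ‖))),
    lt_min hr (div_pos (Real.exp_pos _) hM), fun h h0 h1 w hne hw => ?_⟩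
  by_cases hwr : w ∈ Metric.ball τ (1 - ‖τ‖)
  · refine (min_le_right _ _).trans ?_
    rw [div_le_iff₀' hM]
    refine le_trans ?_ (norm_deriv_le_mul_dist_of_map_eq
      (hφ.isDiskSemigroup.differentiableOn h h0) (hφ.isDiskSemigroup.mapsTo h h0) hφ.mem_disk
      (hφ.map_fixed h0) hwr hne hw)
    rw [(hl h h0).deriv, Complex.norm_exp]
    have h2 : (-l * (h : ℂ)).re = -(l.re * h) := by simp
    rw [h2]
    gcongr
    calc l.re * h ≤ |l.re| * h := by gcongr; exact le_abs_self _
      _ ≤ |l.re| := mul_le_of_le_one_right (abs_nonneg _) h1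
  · exact (min_le_left _ _).trans (by simpa using hwr)

/-- An orbit starting off the Denjoy–Wolff point never reaches it. -/
lemma IsEllipticSemigroup.map_ne {φ : ℝ → ℂ → ℂ} {τ l : ℂ}
    (hφ : IsEllipticSemigroup φ τ) (hl : IsSpectralValue φ τ l) {z : ℂ}
    (hz : z ∈ Metric.ball (0 : ℂ) 1) (hzτ : z ≠ τ) {t : ℝ} (ht : 0 ≤ t) : φ t z ≠ τ := by
  intro htz
  have hs := hφ.isDiskSemigroup
  obtain ⟨c, hc, H⟩ := hφ.exists_pos_le_dist hl
  have htpos : 0 < t := by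
    refine lt_of_le_of_ne ht fun h0 => hzτ ?_
    rw [← htz, ← h0, hs.map_zero z hz]
  -- The steps `t / n` tend to `0` from the right.
  have hstep : Tendsto (fun n : ℕ => t / n) atTop (𝓝[>] 0) := by
    refine tendsto_nhdsWithin_iff.2 ⟨tendsto_const_div_atTop_nhds_zero_nat t, ?_⟩
    filter_upwards [eventually_gt_atTop 0] with n hn
    exact div_pos htpos (by exact_mod_cast hn)
  have hdist : Tendsto (fun n : ℕ => 2 / (1 - ‖z‖) * dist (φ (t / n) z) z) atTop (𝓝 0) := by
    have := ((tendsto_iff_dist_tendsto_zero.1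
      ((hs.tendsto_zero z hz).comp hstep)).const_mul (2 / (1 - ‖z‖)))
    simpa using this
  obtain ⟨n, hn1, hn0, hnc⟩ := ((((tendsto_nhdsWithin_iff.1 hstep).1.eventually
    (eventually_le_nhds one_pos))).and
      ((eventually_gt_atTop 0).and (hdist.eventually (eventually_lt_nhds hc)))).exists
  have hn : (0 : ℝ) < n := by exact_mod_cast hn0
  set h : ℝ := t / n with hh
  have hh0 : 0 ≤ h := by positivity
  classical
  have hex : ∃ k : ℕ, φ (k * h) z = τ := ⟨n, by rw [hh, mul_div_cancel₀ _ hn.ne', htz]⟩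
  have hk := Nat.find_spec hex
  have hmin := fun m => Nat.find_min hex (m := m)
  set k := Nat.find hex
  rcases hk0 : k with _ | m
  · rw [hk0, Nat.cast_zero, zero_mul, hs.map_zero z hz] at hk
    exact hzτ hk
  · have hm0 : (0 : ℝ) ≤ m * h := by positivity
    have hne : φ (m * h) z ≠ τ := hmin m (by omega)
    rw [hk0, Nat.cast_succ, add_mul, one_mul] at hk
    have hk' := hk
    rw [add_comm, hs.map_add h (m * h) hh0 hm0 z hz] at hk
    rw [hs.map_add (m * h) h hm0 hh0 z hz] at hk'
    have h1 := H h hh0 hn1 _ hne hk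
    have h2 := hs.dist_map_le hm0 hz (hs.mapsTo h hh0 hz)
    rw [hk', dist_comm] at h2
    linarith

/-! ### Rate of convergence -/

/-- The rate of convergence along integer times. -/
lemma tendsto_log_norm_nat_div {φ : ℝ → ℂ → ℂ} {τ l : ℂ}
    (hφ : IsEllipticSemigroup φ τ) (hl : IsSpectralValue φ τ l) {z : ℂ}
    (hz : z ∈ Metric.ball (0 : ℂ) 1) (hzτ : z ≠ τ) :
    Tendsto (fun n : ℕ => Real.log ‖φ n z - τ‖ / n) atTop (𝓝 (-l.re)) := by
  have hs := hφ.isDiskSemigroup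
  have hne : ∀ n : ℕ, φ n z ≠ τ := fun n => hφ.map_ne hl hz hzτ n.cast_nonneg
  have hpos : ∀ n : ℕ, ‖φ n z - τ‖ ≠ 0 := fun n => norm_ne_zero_iff.2 (sub_ne_zero.2 (hne n))
  have hlim : Tendsto (fun n : ℕ => φ n z) atTop (𝓝[≠] τ) :=
    tendsto_nhdsWithin_iff.2 ⟨(hφ.isDenjoyWolffPoint.2 z hz).comp tendsto_natCast_atTop_atTop,
      .of_forall hne⟩
  have hslope := ((hasDerivAt_iff_tendsto_slope.1 (hl 1 zero_le_one)).comp hlim).norm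
  have hlog := hslope.log (norm_ne_zero_iff.2 (Complex.exp_ne_zero _))
  have hval : Real.log ‖Complex.exp (-l * ((1 : ℝ) : ℂ))‖ = -l.re := by
    rw [Complex.norm_exp, Real.log_exp]
    simp
  rw [hval] at hlog
  have hdiff : Tendsto (fun n : ℕ => Real.log ‖φ (n + 1 : ℕ) z - τ‖ - Real.log ‖φ n z - τ‖)
      atTop (𝓝 (-l.re)) := by
    refine hlog.congr fun n => ?_
    have hstep : φ (n + 1 : ℕ) z = φ 1 (φ n z) := by
      rw [Nat.cast_succ, add_comm, hs.map_add 1 n zero_le_one n.cast_nonneg z hz]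
    rw [← Real.log_div (hpos _) (hpos _), Function.comp_apply, slope_def_field,
      hφ.map_fixed zero_le_one, norm_div, hstep]
  have hsum := hdiff.cesaro
  simp only [Finset.sum_range_sub (fun n : ℕ => Real.log ‖φ n z - τ‖)] at hsum
  have h0 := tendsto_const_div_atTop_nhds_zero_nat (Real.log ‖φ (0 : ℕ) z - τ‖)
  have := hsum.add h0
  rw [add_zero] at this
  refine this.congr fun n => ?_
  ring

theorem mainTheorem6 (φ : ℝ → ℂ → ℂ) (τ l : ℂ)
    (hφ : IsEllipticSemigroup φ τ) (hl : IsSpectralValue φ τ l)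
    (z : ℂ) (hz : z ∈ Metric.ball (0 : ℂ) 1) (hzτ : z ≠ τ) :
    Tendsto (fun t : ℝ => 1 / t * Real.log ‖φ t z - τ‖) atTop (𝓝 (-l.re)) := by
  have hs := hφ.isDiskSemigroup
  have hr : 0 < 1 - ‖τ‖ := by simpa using hφ.mem_disk
  set C : ℝ := 2 / (1 - ‖τ‖) with hC
  have hC0 : 0 < C := by positivity
  have hpos : ∀ t : ℝ, 0 ≤ t → 0 < ‖φ t z - τ‖ := fun t ht =>
    norm_pos_iff.2 (sub_ne_zero.2 (hφ.map_ne hl hz hzτ ht))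
  -- Later points of the orbit are at most `C` times as far from `τ`.
  have hmono : ∀ s t : ℝ, 0 ≤ s → s ≤ t →
      Real.log ‖φ t z - τ‖ ≤ Real.log C + Real.log ‖φ s z - τ‖ := by
    intro s t h0 hst
    have h1 := hφ.norm_map_sub_le (sub_nonneg.2 hst) (hs.mapsTo s h0 hz)
    rw [← hs.map_add (t - s) s (sub_nonneg.2 hst) h0 z hz, sub_add_cancel] at h1
    rw [← Real.log_mul hC0.ne' (hpos s h0).ne']
    exact Real.log_le_log (hpos t (h0.trans hst)) h1
  have hint := tendsto_log_norm_nat_div hφ hl hz hzτ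
  have hfl : Tendsto (fun t : ℝ => (⌊t⌋₊ : ℝ) / t) atTop (𝓝 1) := tendsto_nat_floor_div_atTop
  have hfl' : Tendsto (fun t : ℝ => ((⌊t⌋₊ + 1 : ℕ) : ℝ) / t) atTop (𝓝 1) := by
    have := hfl.add (tendsto_inv_atTop_zero (𝕜 := ℝ))
    rw [add_zero] at this
    refine this.congr fun t => ?_
    push_cast
    ring
  have hlogC : Tendsto (fun t : ℝ => Real.log C / t) atTop (𝓝 0) :=
    tendsto_const_nhds.div_atTop tendsto_id
  have hup : Tendsto (fun t : ℝ => Real.log ‖φ ⌊t⌋₊ z - τ‖ / ⌊t⌋₊ * (⌊t⌋₊ / t)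
      + Real.log C / t) atTop (𝓝 (-l.re)) := by
    simpa using ((hint.comp tendsto_nat_floor_atTop).mul hfl).add hlogC
  have hlo : Tendsto (fun t : ℝ => Real.log ‖φ (⌊t⌋₊ + 1 : ℕ) z - τ‖ / (⌊t⌋₊ + 1 : ℕ)
      * ((⌊t⌋₊ + 1 : ℕ) / t) - Real.log C / t) atTop (𝓝 (-l.re)) := by
    simpa using ((hint.comp ((tendsto_add_atTop_nat 1).comp
      tendsto_nat_floor_atTop)).mul hfl').sub hlogC
  refine tendsto_of_tendsto_of_tendsto_of_le_of_le' hlo hup ?_ ?_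
  · filter_upwards [eventually_gt_atTop 0] with t ht
    have hn : ((⌊t⌋₊ + 1 : ℕ) : ℝ) ≠ 0 := by positivity
    have h1 := hmono t (⌊t⌋₊ + 1 : ℕ) ht.le (by exact_mod_cast (Nat.lt_floor_add_one t).le)
    rw [div_mul_div_cancel₀ hn, ← sub_div, one_div_mul_eq_div]
    gcongr
    linarith
  · filter_upwards [eventually_ge_atTop 1] with t ht
    have ht0 : 0 < t := by linarith
    have hn : (⌊t⌋₊ : ℝ) ≠ 0 := by
      exact_mod_cast (Nat.floor_pos.2 ht).ne'
    have h1 := hmono ⌊t⌋₊ t (Nat.cast_nonneg _) (Nat.floor_le ht0.le)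
    rw [div_mul_div_cancel₀ hn, ← add_div, one_div_mul_eq_div]
    gcongr
    linarith
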